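/- Let $n\in\{2,3\}$, let $\Omega\subset\mathbb{R}^n$ be open, convex and bounded, and let $\kappa,\tau,c>0$. Consider conforming simplicial triangulations $\mathcal{T}_h$ (finite, nonempty sets of nondegenerate closed simplices $T$, any two of which are disjoint or meet in a common face). Write $\bar\Omega_h=\bigcup_{T\in\mathcal{T}_h}T$, $\Omega_h$ for the interior of $\bar\Omega_h$, $\rho_T$ for the diameter of $T$, $\sigma_T$ for the diameter of the largest ball contained in $T$, and $h=\max_{T}\rho_T$. Assume that $$\frac{\rho_T}{\sigma_T}\le\kappa,\qquad \frac{h}{\rho_T}\le\tau\qquad\text{for all } T\in\mathcal{T}_h,$$ and that either $\Omega_h=\Omega$ (polyhedral case), or $\Omega_h\subset\Omega$, $\bar\Omega_h$ is convex, all vertices of the triangulation on $\partial\Omega_h$ lie on $\partial\Omega$, and $|\Omega\setminus\Omega_h|\le c\,h^2$ (curved case). Let $x_1,\dots,x_{N_h}$ be all the vertices of the triangulation and let $\phi_1,\dots,\phi_{N_h}$ be the nodal basis functions: $\phi_i$ is continuous on $\bar\Omega_h$, affine on each $T$, satisfies $\phi_i(x_j)=\delta_{ij}$, and is $0$ outside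 $\bar\Omega_h$. For $\mathbf z\in\mathbb{R}^{N_h}$ put $$z_h=\sum_{i=1}^{N_h}z_i\phi_i,\qquad \|z_h\|_{L^1_h}=\sum_{i=1}^{N_h}|z_i|\int_{\Omega_h}\phi_i(x)\,dx .$$ Then there is a constant $C>0$, depending only on $n,\Omega,\kappa,\tau,c$ (in particular not on the triangulation, on $h$, or on $\mathbf z$), such that for every such triangulation and every $\mathbf z\in\mathbb{R}^{N_h}$ we have $z_h\in H^1(\Omega_h)$ and $$0\le\|z_h\|_{L^1_h}-\|z_h\|_{L^1(\Omega_h)}\le C\,h\,\|z_h\|_{H^1(\Omega_h)} .$$ Moreover, if $z_h=0$ on $\Omega\setminus\Omega_h$ (which holds trivially if $\Omega_h=\Omega$), then $z_h\in H^1(\Omega)$ and $$0\le\|z_h\|_{L^1_h}-\|z_h\|_{L^1(\Omega)}\le C\,h\,\|z_h\|_{H^1(\Omega)} .$$ Here $\|u\|_{H^1(D)}=\bigl(\int_D|u|^2+\int_D|\nabla u|^2\bigr)^{1/2}$ with the weak gradient $\nabla u$. -/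

import Mathlib

open MeasureTheory Set
open scoped ContDiff

noncomputable section

/-! ### The Sobolev space `H¹` of an open subset of `ℝⁿ` -/

/-- `g` is the weak gradient of `u` on the open set `D`: for every test function
`ψ ∈ C_c^∞(D)` and every direction `v`, `∫_D u ∂_v ψ = - ∫_D ⟪g, v⟫ ψ`. -/
def HasWeakGradient {n : ℕ} (D : Set (EuclideanSpace ℝ (Fin n)))
    (u : EuclideanSpace ℝ (Fin n) → ℝ)
    (g : EuclideanSpace ℝ (Fin n) → EuclideanSpace ℝ (Fin n)) : Prop :=
  LocallyIntegrableOn u D ∧ LocallyIntegrableOn g D ∧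
    ∀ ψ : EuclideanSpace ℝ (Fin n) → ℝ, ContDiff ℝ ∞ ψ → HasCompactSupport ψ →
      tsupport ψ ⊆ D → ∀ v : EuclideanSpace ℝ (Fin n),
        ∫ x in D, u x * fderiv ℝ ψ x v = - ∫ x in D, inner ℝ (g x) v * ψ x

/-- `u ∈ H¹(D)`: `u ∈ L²(D)` and `u` has a weak gradient in `L²(D)`. -/
def MemH1 {n : ℕ} (D : Set (EuclideanSpace ℝ (Fin n)))
    (u : EuclideanSpace ℝ (Fin n) → ℝ) : Prop :=
  MemLp u 2 (volume.restrict D) ∧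
    ∃ g : EuclideanSpace ℝ (Fin n) → EuclideanSpace ℝ (Fin n),
      MemLp g 2 (volume.restrict D) ∧ HasWeakGradient D u g

open Classical in
/-- The weak gradient of `u` on `D` (unique up to a null set); `0` unless `u ∈ H¹(D)`. -/
def weakGradient {n : ℕ} (D : Set (EuclideanSpace ℝ (Fin n)))
    (u : EuclideanSpace ℝ (Fin n) → ℝ) :
    EuclideanSpace ℝ (Fin n) → EuclideanSpace ℝ (Fin n) :=
  if h : MemH1 D u then h.2.choose else 0

/-- `‖u‖_{H¹(D)} = (∫_D u² + ∫_D |∇u|²)^{1/2}`, for `u ∈ H¹(D)`. -/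
def h1Norm {n : ℕ} (D : Set (EuclideanSpace ℝ (Fin n)))
    (u : EuclideanSpace ℝ (Fin n) → ℝ) : ℝ :=
  Real.sqrt ((∫ x in D, u x ^ 2) + ∫ x in D, ‖weakGradient D u x‖ ^ 2)

/-! ### Triangulations -/

/-- A (conforming) triangulation in `ℝⁿ`: a finite, nonempty simplicial complex each of whose
simplices is a face of an `n`-dimensional one. -/
structure Triangulation (n : ℕ) extends
    Geometry.SimplicialComplex ℝ (EuclideanSpace ℝ (Fin n)) where
  finite_faces : faces.Finite
  nonempty_faces : faces.Nonempty
  exists_cell : ∀ s ∈ faces, ∃ t ∈ faces, s ⊆ t ∧ t.card = n + 1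

namespace Triangulation

variable {n : ℕ} (K : Triangulation n)

/-- The cells `T` of the triangulation, each given by its set of `n + 1` vertices; the cell itself
is the convex hull of this set. -/
def cells : Finset (Finset (EuclideanSpace ℝ (Fin n))) :=
  K.finite_faces.toFinset.filter fun t => t.card = n + 1

theorem cells_nonempty : K.cells.Nonempty := by
  obtain ⟨s, hs⟩ := K.nonempty_faces
  obtain ⟨t, ht, -, hc⟩ := K.exists_cell s hs
  exact ⟨t, by simp [cells, ht, hc]⟩

open Classical in
/-- The nodes `x_i`, i.e. the vertices of the cells. -/
def nodes : Finset (EuclideanSpace ℝ (Fin n)) :=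
  K.cells.biUnion id

/-- `Ω_h`, the interior of the union of the cells. -/
def domain : Set (EuclideanSpace ℝ (Fin n)) :=
  interior (⋃ t ∈ K.cells, convexHull ℝ (t : Set (EuclideanSpace ℝ (Fin n))))

/-- `ρ_T`, the diameter of the cell with vertex set `t`. -/
def cellDiam (t : Finset (EuclideanSpace ℝ (Fin n))) : ℝ :=
  Metric.diam (convexHull ℝ (t : Set (EuclideanSpace ℝ (Fin n))))

/-- `σ_T`, the diameter of the largest ball contained in the cell with vertex set `t`. -/
def inDiam (t : Finset (EuclideanSpace ℝ (Fin n))) : ℝ :=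
  sSup {d : ℝ | ∃ (x : EuclideanSpace ℝ (Fin n)) (r : ℝ), 0 ≤ r ∧
    Metric.closedBall x r ⊆ convexHull ℝ (t : Set (EuclideanSpace ℝ (Fin n))) ∧ d = 2 * r}

/-- The mesh size `h = max_T ρ_T`. -/
def meshSize : ℝ := K.cells.sup' K.cells_nonempty cellDiam

/-- `w` is the system of barycentric coordinates of the point `x` in the complex: `x` is the convex
combination, with positive weights, of the vertices of one simplex of the complex. -/
def IsBarycentric (x : EuclideanSpace ℝ (Fin n)) (w : EuclideanSpace ℝ (Fin n) →₀ ℝ) : Prop :=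
  w.support ∈ K.faces ∧ (∀ y, 0 ≤ w y) ∧ ∑ y ∈ w.support, w y = 1 ∧
    ∑ y ∈ w.support, w y • y = x

/-- Barycentric coordinates are unique, so `hat` below is well defined. -/
theorem IsBarycentric.unique {K : Triangulation n} {x : EuclideanSpace ℝ (Fin n)}
    {w₁ w₂ : EuclideanSpace ℝ (Fin n) →₀ ℝ}
    (h₁ : K.IsBarycentric x w₁) (h₂ : K.IsBarycentric x w₂) : w₁ = w₂ := by
  classical
  have aux : ∀ {u : EuclideanSpace ℝ (Fin n) →₀ ℝ}, K.IsBarycentric x u → ∀ s ∈ K.faces,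
      x ∈ convexHull ℝ (s : Set (EuclideanSpace ℝ (Fin n))) → u.support ⊆ s := by
    intro u hu s hs hx
    have hxu : x ∈ convexHull ℝ (u.support : Set (EuclideanSpace ℝ (Fin n))) := by
      rw [Finset.mem_convexHull']
      exact ⟨u, fun y _ => hu.2.1 y, hu.2.2.1, hu.2.2.2⟩
    have hxi := K.inter_subset_convexHull hu.1 hs ⟨hxu, hx⟩
    rw [← Finset.coe_inter, Finset.mem_convexHull'] at hxi
    obtain ⟨a, -, ha1, ha2⟩ := hxi
    have ind := K.indep hu.1
    have key := (affineIndependent_iff_eq_of_fintype_affineCombination_eq ℝ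
      ((↑) : u.support → EuclideanSpace ℝ (Fin n))).1 ind (fun y => u y)
      (fun y => if (y : EuclideanSpace ℝ (Fin n)) ∈ s then a y else 0)
      (by rw [← hu.2.2.1]; exact Finset.sum_coe_sort u.support (fun y => u y))
      (by
        rw [Finset.sum_coe_sort u.support (fun y => if y ∈ s then a y else 0),
          ← Finset.sum_filter, Finset.filter_mem_eq_inter]; exact ha1) (by
        rw [Finset.affineCombination_eq_linear_combination,
          Finset.affineCombination_eq_linear_combination]
        · rw [Finset.sum_coe_sort u.support (fun y => u y • y),
            Finset.sum_coe_sort u.support (fun y => (if y ∈ s then a y else 0) • y)]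
          simp only [ite_smul, zero_smul]
          rw [← Finset.sum_filter, Finset.filter_mem_eq_inter, hu.2.2.2, ha2]
        · rw [Finset.sum_coe_sort u.support (fun y => if y ∈ s then a y else 0),
            ← Finset.sum_filter, Finset.filter_mem_eq_inter]; exact ha1
        · rw [← hu.2.2.1]; exact Finset.sum_coe_sort u.support (fun y => u y))
    intro y hy
    by_contra hys
    have := congrFun key ⟨y, hy⟩
    simp [hys] at this
    exact (Finsupp.mem_support_iff.1 hy) this
  have hull : ∀ {u : EuclideanSpace ℝ (Fin n) →₀ ℝ}, K.IsBarycentric x u →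
      x ∈ convexHull ℝ (u.support : Set (EuclideanSpace ℝ (Fin n))) := by
    intro u hu
    rw [Finset.mem_convexHull']
    exact ⟨u, fun y _ => hu.2.1 y, hu.2.2.1, hu.2.2.2⟩
  have hs : w₁.support = w₂.support :=
    (aux h₁ _ h₂.1 (hull h₂)).antisymm (aux h₂ _ h₁.1 (hull h₁))
  have key := (affineIndependent_iff_eq_of_fintype_affineCombination_eq ℝ
      ((↑) : w₁.support → EuclideanSpace ℝ (Fin n))).1 (K.indep h₁.1) (fun y => w₁ y)
      (fun y => w₂ y)
      (by rw [← h₁.2.2.1]; exact Finset.sum_coe_sort w₁.support (fun y => w₁ y))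
      (by rw [← h₂.2.2.1, ← hs]; exact Finset.sum_coe_sort w₁.support (fun y => w₂ y)) (by
        rw [Finset.affineCombination_eq_linear_combination,
          Finset.affineCombination_eq_linear_combination]
        · rw [Finset.sum_coe_sort w₁.support (fun y => w₁ y • y),
            Finset.sum_coe_sort w₁.support (fun y => w₂ y • y), h₁.2.2.2, hs, h₂.2.2.2]
        · rw [← h₂.2.2.1, ← hs]; exact Finset.sum_coe_sort w₁.support (fun y => w₂ y)
        · rw [← h₁.2.2.1]; exact Finset.sum_coe_sort w₁.support (fun y => w₁ y))
  ext y
  by_cases hy : y ∈ w₁.support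
  · exact congrFun key ⟨y, hy⟩
  · have hy' : y ∉ w₂.support := hs ▸ hy
    rw [Finsupp.notMem_support_iff.1 hy, Finsupp.notMem_support_iff.1 hy']

open Classical in
/-- The nodal basis function `φ_v` of the node `v`: its value at a point of a cell is the
barycentric coordinate of that point with respect to `v`, and it vanishes outside the union of the
cells. So it is affine on each cell, `1` at `v` and `0` at all other nodes. -/
def hat (v x : EuclideanSpace ℝ (Fin n)) : ℝ :=
  if h : ∃ w, K.IsBarycentric x w then h.choose v else 0

/-- The value of a nodal basis function is the barycentric coordinate. -/
theorem hat_eq {x : EuclideanSpace ℝ (Fin n)} {w : EuclideanSpace ℝ (Fin n) →₀ ℝ}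
    (h : K.IsBarycentric x w) (v : EuclideanSpace ℝ (Fin n)) : K.hat v x = w v := by
  have hex : ∃ w, K.IsBarycentric x w := ⟨w, h⟩
  rw [hat, dif_pos hex, hex.choose_spec.unique h]

/-- On the simplex with vertex set `t`, the point with barycentric weights `a` has
nodal basis value `a v` for `v ∈ t`, and `0` for `v ∉ t`. -/
theorem hat_sum {t : Finset (EuclideanSpace ℝ (Fin n))} (ht : t ∈ K.faces)
    (a : EuclideanSpace ℝ (Fin n) → ℝ) (ha : ∀ y ∈ t, 0 ≤ a y) (ha1 : ∑ y ∈ t, a y = 1)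
    (v : EuclideanSpace ℝ (Fin n)) [Decidable (v ∈ t)] :
    K.hat v (∑ y ∈ t, a y • y) = if v ∈ t then a v else 0 := by
  classical
  let w : EuclideanSpace ℝ (Fin n) →₀ ℝ :=
    Finsupp.onFinset t (fun y => if y ∈ t then a y else 0) (by
       intro y hy; by_contra h; simp [h] at hy)
  have hw : ∀ y, w y = if y ∈ t then a y else 0 := fun y => rfl
  have hst : w.support ⊆ t := Finsupp.support_onFinset_subset
  have hs1 : ∑ y ∈ w.support, w y = 1 := by
    rw [← ha1, Finset.sum_subset hst (fun y _ hy => Finsupp.notMem_support_iff.1 hy)]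
    exact Finset.sum_congr rfl fun y hy => by simp [hw, hy]
  have hs2 : ∑ y ∈ w.support, w y • y = ∑ y ∈ t, a y • y := by
    rw [Finset.sum_subset hst (fun y _ hy => by simp [Finsupp.notMem_support_iff.1 hy])]
    exact Finset.sum_congr rfl fun y hy => by simp [hw, hy]
  have hne : w.support.Nonempty := by
    rw [Finset.nonempty_iff_ne_empty]; intro h; simp [h] at hs1
  rw [K.hat_eq (w := w) ⟨K.down_closed ht hst hne, fun y => ?_, hs1, hs2⟩, hw]
  · congr
  · rw [hw]; split_ifs with h
    exacts [ha y h, le_rfl]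

/-- The finite element function `z_h = ∑_i z_i φ_i` with coefficients `z_i`. -/
def feFun (z : K.nodes → ℝ) (x : EuclideanSpace ℝ (Fin n)) : ℝ :=
  ∑ v : K.nodes, z v * K.hat v x

/-- The lumped norm `‖z_h‖_{L¹_h} = ∑_i |z_i| ∫_{Ω_h} φ_i`. -/
def lumpedL1Norm (z : K.nodes → ℝ) : ℝ :=
  ∑ v : K.nodes, |z v| * ∫ x in K.domain, K.hat v x

/-- The triangulation is regular and quasi-uniform with constants `κ` and `τ`. -/
def IsRegularQuasiUniform (κ τ : ℝ) : Prop :=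
  ∀ t ∈ K.cells, cellDiam t / inDiam t ≤ κ ∧ K.meshSize / cellDiam t ≤ τ

/-- The triangulation fits the domain `Ω`: either `Ω_h = Ω` (polyhedral case), or `Ω_h ⊆ Ω`, the
union of the cells is convex, its boundary vertices lie on `∂Ω`, and `|Ω \ Ω_h| ≤ c h²` (case of a
curved boundary). -/
def Fits (Ω : Set (EuclideanSpace ℝ (Fin n))) (c : ℝ) : Prop :=
  K.domain = Ω ∨
    (K.domain ⊆ Ω ∧
      Convex ℝ (⋃ t ∈ K.cells, convexHull ℝ (t : Set (EuclideanSpace ℝ (Fin n)))) ∧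
      (∀ v ∈ K.nodes, v ∈ frontier K.domain → v ∈ frontier Ω) ∧
      volume.real (Ω \ K.domain) ≤ c * K.meshSize ^ 2)

end Triangulation

end

/-! At a point `x` of a cell the hat functions are nonnegative, sum to 1, and vanish for nodes
outside the cell. So `∑ |z_v| φ_v(x) - |z_h(x)|` is a weighted mean of the differences `|z_h(v)| -
|z_h(x)|` over the vertices `v` of the cell. It is nonnegative by the triangle inequality and, `z_h`
being affine there, at most `h |∇z_h|` (`sum_abs_mul_hat_sub_abs_feFun_le`). Integration and
Cauchy–Schwarz turn this into `√|D| · h · ‖∇z_h‖_{L²(D)}`.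

It remains to see that the cellwise gradient is the weak gradient. On a convex `D` with `z_h = 0` on
`D \ Ω_h`, the function `z_h` is Lipschitz (`exists_lipschitzOnWith_feFun`), hence extends to a
Lipschitz `f` on the whole space, and `∇f` is a weak gradient of `z_h` on `D`
(`LipschitzWith.hasWeakGradient`), unique almost everywhere. Both claims are
`lumpedL1Norm_sub_integral_abs`, for `D = Ω_h` and `D = Ω`. -/

open Filter Topology
open scoped NNReal

/-! ### From local to global Lipschitz bounds -/

/-- A real function on a convex set which satisfies a Lipschitz estimate around each point, with
a common constant, is Lipschitz with this constant. -/
theorem Convex.lipschitzOnWith_of_eventually_dist_le {E : Type*} [NormedAddCommGroup E]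
    [NormedSpace ℝ E] {s : Set E} (hs : Convex ℝ s) {f : E → ℝ} {L : ℝ≥0}
    (h : ∀ p ∈ s, ∀ᶠ q in 𝓝[s] p, dist (f q) (f p) ≤ L * dist q p) :
    LipschitzOnWith L f s := by
  have hcont : ContinuousOn f s := by
    intro p hp
    rw [ContinuousWithinAt, tendsto_iff_dist_tendsto_zero]
    have h0 : Tendsto (fun q => (L : ℝ) * dist q p) (𝓝[s] p) (𝓝 0) := by
      have : Tendsto (fun q => (L : ℝ) * dist q p) (𝓝 p) (𝓝 (L * dist p p)) :=
        (by fun_prop : Continuous fun q => (L : ℝ) * dist q p).tendsto p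
      simpa using this.mono_left nhdsWithin_le_nhds
    exact squeeze_zero' (Eventually.of_forall fun _ => dist_nonneg) (h p hp) h0
  refine LipschitzOnWith.of_dist_le_mul fun y hy x hx => ?_
  set γ : ℝ → E := ⇑(AffineMap.lineMap (k := ℝ) x y) with hγ
  have γcont : Continuous γ := AffineMap.lineMap_continuous
  have γs : MapsTo γ (Icc 0 1) s := fun t ht => hs.lineMap_mem hx hy ht
  have γdist : ∀ a b, a ≤ b → dist (γ b) (γ a) = (b - a) * dist y x := fun a b hab => by
    rw [hγ, dist_lineMap_lineMap, Real.dist_eq, abs_of_nonneg (sub_nonneg.2 hab), dist_comm]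
  -- Continuous induction along the segment: the set of good parameters is closed by continuity, and
  -- the local estimate at `γ a` carries it beyond `a`.
  have key : Icc (0 : ℝ) 1 ⊆ {t | dist (f (γ t)) (f x) ≤ L * (t * dist y x)} := by
    apply IsClosed.Icc_subset_of_forall_exists_gt
    · rw [inter_comm]
      have hc : ContinuousOn (fun t => dist (f (γ t)) (f x) - L * (t * dist y x)) (Icc 0 1) := by
        have hfγ : ContinuousOn (fun t => f (γ t)) (Icc 0 1) := hcont.comp γcont.continuousOn γs
        fun_prop
      have := hc.preimage_isClosed_of_isClosed isClosed_Icc isClosed_Iic (t := Iic 0)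
      convert this using 1
      ext t
      simp
    · simp [hγ]
    · rintro a ⟨ha, ha0, ha1⟩ b hb
      have hev : ∀ᶠ t in 𝓝[>] a, dist (f (γ t)) (f (γ a)) ≤ L * dist (γ t) (γ a) := by
        have ht : Tendsto γ (𝓝[>] a) (𝓝[s] (γ a)) := by
          refine tendsto_nhdsWithin_iff.2 ⟨γcont.continuousWithinAt, ?_⟩
          filter_upwards [Ioc_mem_nhdsGT ha1] with t ht
          exact γs ⟨ha0.trans ht.1.le, ht.2⟩
        exact ht.eventually (h _ (γs ⟨ha0, ha1.le⟩))
      obtain ⟨t, ht, htb⟩ := (hev.and (Ioc_mem_nhdsGT hb)).exists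
      refine ⟨t, ?_, htb⟩
      rw [γdist a t htb.1.le] at ht
      have h3 := dist_triangle (f (γ t)) (f (γ a)) (f x)
      simp only [mem_ofPred_eq] at ha ⊢
      nlinarith
  simpa [hγ] using key (right_mem_Icc.2 zero_le_one)

/-! ### Weak gradients of Lipschitz functions -/

section WeakGradient

variable {n : ℕ} {D : Set (EuclideanSpace ℝ (Fin n))} {u f : EuclideanSpace ℝ (Fin n) → ℝ}

theorem LipschitzWith.norm_gradient_le {L : ℝ≥0} (hf : LipschitzWith L f)
    (x : EuclideanSpace ℝ (Fin n)) : ‖gradient f x‖ ≤ L := by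
  rw [gradient, LinearIsometryEquiv.norm_map]
  exact norm_fderiv_le_of_lipschitz ℝ hf

theorem measurable_gradient (f : EuclideanSpace ℝ (Fin n) → ℝ) : Measurable (gradient f) :=
  (LinearIsometryEquiv.continuous _).measurable.comp (measurable_fderiv ℝ f)

theorem LipschitzWith.memLp_gradient {L : ℝ≥0} (hf : LipschitzWith L f)
    (p : ENNReal) (μ : Measure (EuclideanSpace ℝ (Fin n))) [IsFiniteMeasure μ] :
    MemLp (gradient f) p μ :=
  MemLp.of_bound (measurable_gradient f).aestronglyMeasurable L
    (Eventually.of_forall hf.norm_gradient_le)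

/-- The gradient of a Lipschitz function is its weak gradient. -/
theorem LipschitzWith.hasWeakGradient {L : ℝ≥0} (hf : LipschitzWith L f) (hD : IsOpen D)
    (hu : EqOn u f D) : HasWeakGradient D u (gradient f) := by
  refine ⟨?_, ?_, fun ψ hψ hψc hψD v => ?_⟩
  · exact (hf.continuous.continuousOn.congr hu).locallyIntegrableOn hD.measurableSet
  · refine LocallyIntegrable.locallyIntegrableOn ?_ D
    exact (memLp_top_of_bound (measurable_gradient f).aestronglyMeasurable L
      (Eventually.of_forall hf.norm_gradient_le)).locallyIntegrable le_top
  · obtain ⟨M, hM⟩ := (hψ.of_le (by simp : (1 : WithTop ℕ∞) ≤ ∞)).lipschitzWith_of_hasCompactSupport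
      hψc one_ne_zero
    -- Integration by parts for two Lipschitz functions, one compactly supported; the minus sign
    -- appears as the direction `-v` on `ψ`.
    have hparts := hf.integral_lineDeriv_mul_eq (μ := volume) hM hψc v
    have h0 : ∀ x ∉ D, ψ x = 0 := fun x hx => image_eq_zero_of_notMem_tsupport fun h => hx (hψD h)
    have h1 : ∀ x ∉ D, fderiv ℝ ψ x = 0 := fun x hx =>
      image_eq_zero_of_notMem_tsupport fun h => hx (hψD (tsupport_fderiv_subset ℝ h))
    have hψd : Differentiable ℝ ψ := hψ.differentiable (by simp)
    calc ∫ x in D, u x * fderiv ℝ ψ x v = ∫ x in D, f x * fderiv ℝ ψ x v :=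
          setIntegral_congr_fun hD.measurableSet fun x hx => by simp only [hu hx]
      _ = ∫ x, f x * fderiv ℝ ψ x v :=
          setIntegral_eq_integral_of_forall_compl_eq_zero fun x hx => by simp [h1 x hx]
      _ = - ∫ x, lineDeriv ℝ ψ x (-v) * f x := by
          rw [← integral_neg]
          refine integral_congr_ae (Eventually.of_forall fun x => ?_)
          simp [(hψd x).lineDeriv_eq_fderiv, mul_comm]
      _ = - ∫ x, inner ℝ (gradient f x) v * ψ x := by
          rw [← hparts]
          congr 1
          refine integral_congr_ae ?_
          filter_upwards [hf.ae_differentiableAt (μ := volume)] with x hx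
          rw [hx.lineDeriv_eq_fderiv, gradient, InnerProductSpace.toDual_symm_apply]
      _ = - ∫ x in D, inner ℝ (gradient f x) v * ψ x := by
          rw [setIntegral_eq_integral_of_forall_compl_eq_zero fun x hx => by simp [h0 x hx]]

/-- Weak gradients are unique up to null sets. -/
theorem HasWeakGradient.ae_eq {g₁ g₂ : EuclideanSpace ℝ (Fin n) → EuclideanSpace ℝ (Fin n)}
    (hD : IsOpen D) (h₁ : HasWeakGradient D u g₁) (h₂ : HasWeakGradient D u g₂) :
    g₁ =ᵐ[volume.restrict D] g₂ := by
  have hint : ∀ {g : EuclideanSpace ℝ (Fin n) → EuclideanSpace ℝ (Fin n)},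
      LocallyIntegrableOn g D → ∀ ψ : EuclideanSpace ℝ (Fin n) → ℝ, ContDiff ℝ ∞ ψ →
      HasCompactSupport ψ → tsupport ψ ⊆ D → IntegrableOn (fun x => ψ x • g x) D := by
    intro g hg ψ hψ hψc hψD
    have := (hg.integrableOn_compact_subset hψD hψc).continuousOn_smul
      hψ.continuous.continuousOn hψc
    have h2 : Integrable (fun x => ψ x • g x) := by
      rwa [integrableOn_iff_integrable_of_support_subset] at this
      exact (Function.support_smul_subset_left _ _).trans (subset_tsupport ψ)
    exact h2.integrableOn
  -- Fundamental lemma of the calculus of variations for `g₁ - g₂`; the vector-valued integrals are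
  -- compared by pairing with each `v`.
  have key := hD.ae_eq_zero_of_integral_contDiff_smul_eq_zero (μ := volume)
    (h₁.2.1.sub h₂.2.1) fun ψ hψ hψc hψD => ?_
  · rw [EventuallyEq, ae_restrict_iff' hD.measurableSet]
    filter_upwards [key] with x hx hxD
    exact sub_eq_zero.1 (hx hxD)
  · rw [← setIntegral_eq_integral_of_forall_compl_eq_zero (s := D) fun x hx => by
      rw [image_eq_zero_of_notMem_tsupport fun h => hx (hψD h), zero_smul]]
    simp only [Pi.sub_apply, smul_sub]
    rw [integral_sub (hint h₁.2.1 ψ hψ hψc hψD) (hint h₂.2.1 ψ hψ hψc hψD), sub_eq_zero]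
    refine ext_inner_left ℝ fun v => ?_
    rw [← integral_inner (hint h₁.2.1 ψ hψ hψc hψD), ← integral_inner (hint h₂.2.1 ψ hψ hψc hψD)]
    have := neg_injective ((h₁.2.2 ψ hψ hψc hψD v).symm.trans (h₂.2.2 ψ hψ hψc hψD v))
    simpa only [inner_smul_right, real_inner_comm, mul_comm] using this

theorem LipschitzWith.memH1 {L : ℝ≥0} (hf : LipschitzWith L f) (hD : IsOpen D)
    (hDb : Bornology.IsBounded D) (hu : EqOn u f D) : MemH1 D u := by
  have : IsFiniteMeasure (volume.restrict D) := ⟨by simpa using hDb.measure_lt_top⟩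
  refine ⟨?_, gradient f, hf.memLp_gradient 2 _, hf.hasWeakGradient hD hu⟩
  obtain ⟨B, hB⟩ := (hDb.isCompact_closure.image hf.continuous).isBounded.exists_norm_le
  have : MemLp f 2 (volume.restrict D) :=
    MemLp.of_bound hf.continuous.aestronglyMeasurable B <| by
      filter_upwards [ae_restrict_mem hD.measurableSet] with x hx
      exact hB _ ⟨x, subset_closure hx, rfl⟩
  refine this.ae_eq ?_
  filter_upwards [ae_restrict_mem hD.measurableSet] with x hx
  exact (hu hx).symm

theorem LipschitzWith.weakGradient_ae_eq {L : ℝ≥0} (hf : LipschitzWith L f) (hD : IsOpen D)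
    (hDb : Bornology.IsBounded D) (hu : EqOn u f D) :
    weakGradient D u =ᵐ[volume.restrict D] gradient f := by
  have hm := hf.memH1 hD hDb hu
  rw [weakGradient, dif_pos hm]
  exact hm.2.choose_spec.2.ae_eq hD (hf.hasWeakGradient hD hu)

/-- The `L¹` norm of the gradient is bounded by the `H¹` norm. -/
theorem LipschitzWith.integral_norm_gradient_le_h1Norm {L : ℝ≥0} (hf : LipschitzWith L f)
    (hD : IsOpen D) (hDb : Bornology.IsBounded D) (hu : EqOn u f D) :
    ∫ x in D, ‖gradient f x‖ ≤ Real.sqrt (volume.real D) * h1Norm D u := by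
  have : IsFiniteMeasure (volume.restrict D) := ⟨by simpa using hDb.measure_lt_top⟩
  have hg := (hf.memLp_gradient 2 (volume.restrict D)).norm
  -- Cauchy–Schwarz against the constant 1, the source of the factor `√|D|`.
  have hcs := integral_mul_le_Lp_mul_Lq_of_nonneg (μ := volume.restrict D)
    Real.HolderConjugate.two_two (f := fun _ => (1 : ℝ)) (g := fun x => ‖gradient f x‖)
    (Eventually.of_forall fun _ => zero_le_one) (Eventually.of_forall fun _ => norm_nonneg _)
    (memLp_const 1) (by simpa using hg)
  have heq : ∫ x in D, ‖weakGradient D u x‖ ^ 2 = ∫ x in D, ‖gradient f x‖ ^ 2 :=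
    integral_congr_ae <| by
      filter_upwards [hf.weakGradient_ae_eq hD hDb hu] with x hx
      rw [hx]
  simp only [one_mul, one_pow, integral_const, smul_eq_mul, mul_one,
    measureReal_restrict_apply_univ, Real.rpow_ofNat, ← Real.sqrt_eq_rpow] at hcs
  refine hcs.trans ?_
  rw [h1Norm, heq]
  gcongr
  have h0 : 0 ≤ ∫ x in D, u x ^ 2 := integral_nonneg fun x => sq_nonneg (u x)
  linarith

end WeakGradient

/-! ### Finite element functions on a single cell -/

namespace Triangulation

variable {n : ℕ} (K : Triangulation n)

theorem mem_cells {t : Finset (EuclideanSpace ℝ (Fin n))} :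
    t ∈ K.cells ↔ t ∈ K.faces ∧ t.card = n + 1 := by
  simp [cells]

theorem subset_nodes {t : Finset (EuclideanSpace ℝ (Fin n))} (ht : t ∈ K.cells) :
    t ⊆ K.nodes := fun _ hv => Finset.mem_biUnion.2 ⟨t, ht, hv⟩

theorem hat_nonneg (v x : EuclideanSpace ℝ (Fin n)) : 0 ≤ K.hat v x := by
  rw [hat]
  split_ifs with h
  exacts [h.choose_spec.2.1 v, le_rfl]

section Cell

variable {K} {t : Finset (EuclideanSpace ℝ (Fin n))} (ht : t ∈ K.cells)
  {x : EuclideanSpace ℝ (Fin n)}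

include ht

theorem hat_eq_zero_of_notMem (hx : x ∈ convexHull ℝ (t : Set (EuclideanSpace ℝ (Fin n))))
    {v : EuclideanSpace ℝ (Fin n)} (hv : v ∉ t) : K.hat v x = 0 := by
  classical
  obtain ⟨a, ha, ha1, rfl⟩ := Finset.mem_convexHull'.1 hx
  rw [K.hat_sum (K.mem_cells.1 ht).1 a ha ha1, if_neg hv]

theorem sum_hat (hx : x ∈ convexHull ℝ (t : Set (EuclideanSpace ℝ (Fin n)))) :
    ∑ v : K.nodes, K.hat v x = 1 := by
  classical
  obtain ⟨a, ha, ha1, rfl⟩ := Finset.mem_convexHull'.1 hx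
  rw [Finset.sum_coe_sort K.nodes (fun v => K.hat v (∑ y ∈ t, a y • y))]
  simp_rw [K.hat_sum (K.mem_cells.1 ht).1 a ha ha1]
  rw [← Finset.sum_filter, Finset.filter_mem_eq_inter,
    Finset.inter_eq_right.2 (K.subset_nodes ht), ha1]

/-- A nodal basis function is affine on each cell. -/
theorem exists_hat_eq_affine (v : EuclideanSpace ℝ (Fin n)) :
    ∃ (l : EuclideanSpace ℝ (Fin n) →L[ℝ] ℝ) (c : ℝ),
      ∀ x ∈ convexHull ℝ (t : Set (EuclideanSpace ℝ (Fin n))), K.hat v x = l x + c := by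
  classical
  by_cases hv : v ∈ t
  · obtain ⟨htf, hcard⟩ := K.mem_cells.1 ht
    -- The `n + 1` independent vertices of a cell form an affine basis, so the barycentric
    -- coordinate extends to an affine function on the whole space.
    have hspan : affineSpan ℝ (Set.range ((↑) : t → EuclideanSpace ℝ (Fin n))) = ⊤ := by
      rw [(K.indep htf).affineSpan_eq_top_iff_card_eq_finrank_add_one]
      simpa using hcard
    let b : AffineBasis t ℝ (EuclideanSpace ℝ (Fin n)) := ⟨(↑), K.indep htf, hspan⟩
    refine ⟨(b.coord ⟨v, hv⟩).linear.toContinuousLinearMap, b.coord ⟨v, hv⟩ 0, fun x hx => ?_⟩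
    obtain ⟨a, ha, ha1, rfl⟩ := Finset.mem_convexHull'.1 hx
    rw [K.hat_sum htf a ha ha1, if_pos hv]
    have hsum : ∑ y : t, a y = 1 := by rw [← ha1]; exact Finset.sum_coe_sort t a
    have hcomb : (Finset.univ : Finset t).affineCombination ℝ b (fun y => a y)
        = ∑ y ∈ t, a y • y := by
      rw [Finset.affineCombination_eq_linear_combination _ _ _ hsum]
      exact Finset.sum_coe_sort t (fun y => a y • y)
    have hc := b.coord_apply_combination_of_mem (Finset.mem_univ ⟨v, hv⟩) hsum
    rw [hcomb] at hc
    rw [← hc]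
    exact congrFun (AffineMap.decomp (b.coord ⟨v, hv⟩)) _
  · exact ⟨0, 0, fun x hx => by simp [hat_eq_zero_of_notMem ht hx hv]⟩

/-- A finite element function is affine on each cell. -/
theorem exists_feFun_eq_affine (z : K.nodes → ℝ) :
    ∃ (l : EuclideanSpace ℝ (Fin n) →L[ℝ] ℝ) (c : ℝ),
      ∀ x ∈ convexHull ℝ (t : Set (EuclideanSpace ℝ (Fin n))), K.feFun z x = l x + c := by
  choose l c h using fun v : K.nodes => exists_hat_eq_affine ht (v : EuclideanSpace ℝ (Fin n))
  refine ⟨∑ v, z v • l v, ∑ v, z v * c v, fun x hx => ?_⟩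
  simp only [feFun, sum_apply, smul_apply, smul_eq_mul]
  rw [← Finset.sum_add_distrib]
  exact Finset.sum_congr rfl fun v _ => by rw [h v x hx, mul_add]

theorem feFun_apply_vertex (z : K.nodes → ℝ) {v : K.nodes}
    (hv : (v : EuclideanSpace ℝ (Fin n)) ∈ t) :
    K.feFun z v = z v := by
  classical
  have hx : ∑ y ∈ t, (if y = v then (1 : ℝ) else 0) • y = (v : EuclideanSpace ℝ (Fin n)) := by
    simp [hv]
  have hhat : ∀ w : K.nodes, K.hat w v = if w = v then 1 else 0 := fun w => by
    have h := K.hat_sum (K.mem_cells.1 ht).1 (fun y => if y = v then (1 : ℝ) else 0)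
      (fun y _ => by positivity) (by simp [hv]) w
    rw [hx] at h
    rw [h]
    by_cases hw : w = v
    · simp [hw, hv]
    · simp [hw]
  simp [feFun, hhat]

theorem cellDiam_le_meshSize : cellDiam t ≤ K.meshSize :=
  Finset.le_sup' cellDiam ht

/-- On a cell, the lumping error is at most the mesh size times the slope of the finite element
function. -/
theorem sum_abs_mul_hat_sub_abs_feFun_le (z : K.nodes → ℝ)
    {l : EuclideanSpace ℝ (Fin n) →L[ℝ] ℝ} {c : ℝ}
    (hl : ∀ x ∈ convexHull ℝ (t : Set (EuclideanSpace ℝ (Fin n))), K.feFun z x = l x + c)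
    (hx : x ∈ convexHull ℝ (t : Set (EuclideanSpace ℝ (Fin n)))) :
    ∑ v : K.nodes, |z v| * K.hat v x - |K.feFun z x| ≤ K.meshSize * ‖l‖ := by
  -- Weighting by the hat functions makes nodes outside the cell harmless, as both sides vanish
  -- there; summing over `v` then uses the partition of unity.
  have hterm : ∀ v : K.nodes,
      (|z v| - |K.feFun z x|) * K.hat v x ≤ K.meshSize * ‖l‖ * K.hat v x := by
    intro v
    by_cases hv : (v : EuclideanSpace ℝ (Fin n)) ∈ t
    · refine mul_le_mul_of_nonneg_right ?_ (K.hat_nonneg _ _)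
      have hvt : (v : EuclideanSpace ℝ (Fin n)) ∈
        convexHull ℝ (t : Set (EuclideanSpace ℝ (Fin n))) := subset_convexHull ℝ _ hv
      have hdist : dist (v : EuclideanSpace ℝ (Fin n)) x ≤ K.meshSize :=
        (Metric.dist_le_diam_of_mem
          ((isBounded_convexHull.2 t.finite_toSet.isBounded)) hvt hx).trans
          (cellDiam_le_meshSize ht)
      calc |z v| - |K.feFun z x| ≤ |z v - K.feFun z x| := abs_sub_abs_le_abs_sub _ _
        _ = ‖l (v - x)‖ := by
          rw [← feFun_apply_vertex ht z hv, hl _ hvt, hl _ hx, map_sub, Real.norm_eq_abs]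
          congr 1; ring
        _ ≤ ‖l‖ * ‖(v : EuclideanSpace ℝ (Fin n)) - x‖ := l.le_opNorm _
        _ ≤ ‖l‖ * K.meshSize := by
          rw [← dist_eq_norm]; gcongr
        _ = K.meshSize * ‖l‖ := mul_comm _ _
    · simp [hat_eq_zero_of_notMem ht hx hv]
  have hsum := Finset.sum_le_sum fun v (_ : v ∈ Finset.univ) => hterm v
  simp only [sub_mul, Finset.sum_sub_distrib, ← Finset.mul_sum, sum_hat ht hx, mul_one] at hsum
  exact hsum

end Cell

/-! ### Global regularity and integral form of the lumped norm -/

theorem meshSize_nonneg : 0 ≤ K.meshSize := by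
  obtain ⟨t, ht⟩ := K.cells_nonempty
  exact Metric.diam_nonneg.trans (cellDiam_le_meshSize ht)

theorem isOpen_domain : IsOpen K.domain := isOpen_interior

theorem feFun_eq_zero (z : K.nodes → ℝ) {x : EuclideanSpace ℝ (Fin n)}
    (hx : x ∉ ⋃ t ∈ K.cells, convexHull ℝ (t : Set (EuclideanSpace ℝ (Fin n)))) :
    K.feFun z x = 0 := by
  refine Finset.sum_eq_zero fun v _ => ?_
  rw [hat, dif_neg, mul_zero]
  rintro ⟨w, hw, hw0, hw1, hwx⟩
  obtain ⟨t, ht, hst, hcard⟩ := K.exists_cell _ hw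
  refine hx (mem_iUnion₂.2 ⟨t, K.mem_cells.2 ⟨ht, hcard⟩, convexHull_mono hst ?_⟩)
  exact Finset.mem_convexHull'.2 ⟨w, fun y _ => hw0 y, hw1, hwx⟩

/-- Almost every point of `Ω_h` is in the interior of a cell. -/
theorem ae_mem_interior_cell : ∀ᵐ x : EuclideanSpace ℝ (Fin n), x ∈ K.domain →
    ∃ t ∈ K.cells, x ∈ interior (convexHull ℝ (t : Set (EuclideanSpace ℝ (Fin n)))) := by
  have h : ∀ᵐ x : EuclideanSpace ℝ (Fin n), ∀ t ∈ K.cells,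
      x ∉ frontier (convexHull ℝ (t : Set (EuclideanSpace ℝ (Fin n)))) :=
    (ae_ball_iff K.cells.countable_toSet).2 fun t _ =>
      measure_eq_zero_iff_ae_notMem.1 ((convex_convexHull ℝ _).addHaar_frontier volume)
  filter_upwards [h] with x hx hxD
  obtain ⟨t, ht, hxt⟩ := mem_iUnion₂.1 (interior_subset hxD)
  refine ⟨t, ht, ?_⟩
  by_contra hxi
  exact hx t ht ⟨subset_closure hxt, hxi⟩

/-- A finite element function which vanishes on `D \ Ω_h` is Lipschitz on the open convex
set `D`. -/
theorem exists_lipschitzOnWith_feFun {D : Set (EuclideanSpace ℝ (Fin n))}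
    (hD : Convex ℝ D) (z : K.nodes → ℝ) (hz : ∀ x ∈ D \ K.domain, K.feFun z x = 0) :
    ∃ L : ℝ≥0, LipschitzOnWith L (K.feFun z) D := by
  choose l c h using fun t : K.cells => exists_feFun_eq_affine t.2 z
  -- The sum of the slopes dominates the slope on every cell.
  refine ⟨∑ t, ‖l t‖₊, hD.lipschitzOnWith_of_eventually_dist_le fun p hp => ?_⟩
  -- Cells are closed and finitely many, so every cell meeting a small neighbourhood of `p` contains
  -- `p`: a nearby `q` in some cell shares it with `p`.
  have hcells : ∀ᶠ q in 𝓝 p, ∀ t ∈ K.cells,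
      q ∈ convexHull ℝ (t : Set (EuclideanSpace ℝ (Fin n))) →
      p ∈ convexHull ℝ (t : Set (EuclideanSpace ℝ (Fin n))) := by
    rw [Filter.eventually_all_finset]
    intro t _
    by_cases hpt : p ∈ convexHull ℝ (t : Set (EuclideanSpace ℝ (Fin n)))
    · exact Eventually.of_forall fun _ _ => hpt
    · filter_upwards [(t.finite_toSet.isCompact_convexHull ℝ).isClosed.isOpen_compl.mem_nhds hpt]
        with q hq hq'
      exact absurd hq' hq
  have hdom : ∀ᶠ q in 𝓝 p, p ∈ K.domain → q ∈ K.domain := by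
    by_cases hpD : p ∈ K.domain
    · filter_upwards [K.isOpen_domain.mem_nhds hpD] with q hq _ using hq
    · exact Eventually.of_forall fun _ h => absurd h hpD
  filter_upwards [nhdsWithin_le_nhds hcells, nhdsWithin_le_nhds hdom] with q hq hqD
  by_cases hqU : q ∈ ⋃ t ∈ K.cells, convexHull ℝ (t : Set (EuclideanSpace ℝ (Fin n)))
  · obtain ⟨t, ht, hqt⟩ := mem_iUnion₂.1 hqU
    have hle : ‖l ⟨t, ht⟩‖₊ ≤ ∑ t, ‖l t‖₊ :=
      Finset.single_le_sum (f := fun t => ‖l t‖₊) (fun _ _ => zero_le) (Finset.mem_univ _)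
    rw [h ⟨t, ht⟩ q hqt, h ⟨t, ht⟩ p (hq t ht hqt), dist_add_right, dist_eq_norm, dist_eq_norm,
      ← map_sub]
    refine ((l ⟨t, ht⟩).le_opNorm _).trans ?_
    gcongr
    exact_mod_cast hle
  -- With `q` outside all cells, `p` cannot lie in the open set `Ω_h`, so `z_h` vanishes at both
  -- points; the assumption on `D \ Ω_h` rules out a jump across `∂Ω_h`.
  · have hpD : p ∉ K.domain := fun hpD => hqU (interior_subset (hqD hpD))
    rw [K.feFun_eq_zero z hqU, hz p ⟨hp, hpD⟩, dist_self]
    positivity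

theorem feFun_single [DecidableEq K.nodes] (v : K.nodes) (x : EuclideanSpace ℝ (Fin n)) :
    K.feFun (Pi.single v 1) x = K.hat v x := by
  simp [feFun, Pi.single_apply]

theorem abs_feFun_le (z : K.nodes → ℝ) (x : EuclideanSpace ℝ (Fin n)) :
    |K.feFun z x| ≤ ∑ v : K.nodes, |z v| * K.hat v x := by
  refine (Finset.abs_sum_le_sum_abs _ _).trans_eq (Finset.sum_congr rfl fun v _ => ?_)
  rw [abs_mul, abs_of_nonneg (K.hat_nonneg _ _)]

theorem isBounded_domain : Bornology.IsBounded K.domain := by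
  refine Bornology.IsBounded.subset ?_ interior_subset
  exact (Bornology.isBounded_biUnion_finset K.cells).2 fun t _ =>
    isBounded_convexHull.2 t.finite_toSet.isBounded

theorem integrableOn_feFun (hconv : Convex ℝ K.domain) (z : K.nodes → ℝ) :
    IntegrableOn (K.feFun z) K.domain := by
  obtain ⟨L, hL⟩ := K.exists_lipschitzOnWith_feFun hconv z fun x hx => absurd hx.1 hx.2
  obtain ⟨f, hf, hfz⟩ := hL.extend_real
  have : IsFiniteMeasure (volume.restrict K.domain) :=
    ⟨by simpa using K.isBounded_domain.measure_lt_top⟩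
  exact (hf.memH1 K.isOpen_domain K.isBounded_domain hfz).1.integrable (by norm_num)

theorem lumpedL1Norm_eq_integral (hconv : Convex ℝ K.domain) (z : K.nodes → ℝ) :
    K.lumpedL1Norm z = ∫ x in K.domain, ∑ v : K.nodes, |z v| * K.hat v x := by
  classical
  rw [lumpedL1Norm, integral_finsetSum]
  · simp_rw [integral_const_mul]
  · intro v _
    have := K.integrableOn_feFun hconv (Pi.single v 1)
    simp_rw [funext (K.feFun_single v)] at this
    exact this.const_mul _

theorem convex_domain {Ω : Set (EuclideanSpace ℝ (Fin n))} (hΩ : Convex ℝ Ω) {c : ℝ}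
    (hK : K.Fits Ω c) : Convex ℝ K.domain := by
  rcases hK with h | h
  exacts [h ▸ hΩ, h.2.1.interior]

theorem domain_subset {Ω : Set (EuclideanSpace ℝ (Fin n))} {c : ℝ} (hK : K.Fits Ω c) :
    K.domain ⊆ Ω := by
  rcases hK with h | h
  exacts [h.subset, h.1]

/-! ### The lumping estimate -/

/-- The error of mass lumping in the `L¹` norm on a convex open set `D` containing `Ω_h`, for
finite element functions which vanish on `D \ Ω_h`. -/
theorem lumpedL1Norm_sub_integral_abs {D : Set (EuclideanSpace ℝ (Fin n))} (hDo : IsOpen D)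
    (hDc : Convex ℝ D) (hDb : Bornology.IsBounded D) (hconv : Convex ℝ K.domain)
    (hsub : K.domain ⊆ D) (z : K.nodes → ℝ) (hz : ∀ x ∈ D \ K.domain, K.feFun z x = 0) :
    MemH1 D (K.feFun z) ∧ 0 ≤ K.lumpedL1Norm z - ∫ x in D, |K.feFun z x| ∧
      K.lumpedL1Norm z - ∫ x in D, |K.feFun z x| ≤
        Real.sqrt (volume.real D) * K.meshSize * h1Norm D (K.feFun z) := by
  classical
  obtain ⟨L, hL⟩ := K.exists_lipschitzOnWith_feFun hDc z hz
  obtain ⟨f, hf, hfz⟩ := hL.extend_real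
  have hfin : IsFiniteMeasure (volume.restrict D) := ⟨by simpa using hDb.measure_lt_top⟩
  have hgrad : IntegrableOn (fun x => ‖gradient f x‖) D :=
    ((hf.memLp_gradient 1 (volume.restrict D)).integrable le_rfl).norm
  have habs : ∫ x in D, |K.feFun z x| = ∫ x in K.domain, |K.feFun z x| :=
    setIntegral_eq_of_subset_of_forall_sdiff_eq_zero hDo.measurableSet hsub
      fun x hx => by rw [hz x hx, abs_zero]
  have hint := (K.integrableOn_feFun hconv z).abs
  -- The lumped integrand is itself the finite element function with coefficients `|z v|`.
  have hint' : IntegrableOn (fun x => ∑ v : K.nodes, |z v| * K.hat v x) K.domain :=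
    K.integrableOn_feFun hconv fun v => |z v|
  have hdiff : K.lumpedL1Norm z - ∫ x in D, |K.feFun z x| =
      ∫ x in K.domain, (∑ v : K.nodes, |z v| * K.hat v x - |K.feFun z x|) := by
    rw [habs, K.lumpedL1Norm_eq_integral hconv, ← integral_sub hint' hint]
  refine ⟨hf.memH1 hDo hDb hfz, ?_, ?_⟩
  · rw [hdiff]
    exact integral_nonneg fun x => sub_nonneg.2 (K.abs_feFun_le z x)
  have hle : ∀ᵐ x ∂volume.restrict K.domain,
      ∑ v : K.nodes, |z v| * K.hat v x - |K.feFun z x| ≤ K.meshSize * ‖gradient f x‖ := by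
    rw [ae_restrict_iff' K.isOpen_domain.measurableSet]
    filter_upwards [K.ae_mem_interior_cell] with x hx hxD
    obtain ⟨t, ht, hxt⟩ := hx hxD
    obtain ⟨l, c, hl⟩ := exists_feFun_eq_affine ht z
    -- In the interior of a cell `f` coincides locally with the affine piece, so its gradient has
    -- norm `‖l‖`.
    have hfl : f =ᶠ[𝓝 x] fun y => l y + c := by
      filter_upwards [mem_interior_iff_mem_nhds.1 hxt, K.isOpen_domain.mem_nhds hxD] with y hy hyD
      rw [← hfz (hsub hyD), hl y hy]
    have hfd : fderiv ℝ f x = l :=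
      ((l.hasFDerivAt.add_const c).congr_of_eventuallyEq hfl).fderiv
    rw [gradient, LinearIsometryEquiv.norm_map, hfd]
    exact sum_abs_mul_hat_sub_abs_feFun_le ht z hl (interior_subset hxt)
  calc K.lumpedL1Norm z - ∫ x in D, |K.feFun z x|
      ≤ ∫ x in K.domain, K.meshSize * ‖gradient f x‖ := by
        rw [hdiff]
        exact integral_mono_ae (hint'.sub hint) ((hgrad.mono_set hsub).const_mul _) hle
    _ = K.meshSize * ∫ x in K.domain, ‖gradient f x‖ := integral_const_mul _ _
    _ ≤ K.meshSize * ∫ x in D, ‖gradient f x‖ :=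
        mul_le_mul_of_nonneg_left
          (setIntegral_mono_set hgrad (Eventually.of_forall fun _ => norm_nonneg _)
            hsub.eventuallyLE) K.meshSize_nonneg
    _ ≤ K.meshSize * (Real.sqrt (volume.real D) * h1Norm D (K.feFun z)) :=
        mul_le_mul_of_nonneg_left (hf.integral_norm_gradient_le_h1Norm hDo hDb hfz)
          K.meshSize_nonneg
    _ = Real.sqrt (volume.real D) * K.meshSize * h1Norm D (K.feFun z) := by ring

end Triangulation

theorem mainTheorem4 {n : ℕ} (hn : n = 2 ∨ n = 3)
    (Ω : Set (EuclideanSpace ℝ (Fin n))) (hΩ_open : IsOpen Ω) (hΩ_convex : Convex ℝ Ω)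
    (hΩ_bdd : Bornology.IsBounded Ω)
    (κ τ c : ℝ) (hκ : 0 < κ) (hτ : 0 < τ) (hc : 0 < c) :
    ∃ C : ℝ, 0 < C ∧
      ∀ K : Triangulation n, K.IsRegularQuasiUniform κ τ → K.Fits Ω c →
        ∀ z : K.nodes → ℝ,
          (MemH1 K.domain (K.feFun z) ∧
            0 ≤ K.lumpedL1Norm z - ∫ x in K.domain, |K.feFun z x| ∧
            K.lumpedL1Norm z - ∫ x in K.domain, |K.feFun z x| ≤
              C * K.meshSize * h1Norm K.domain (K.feFun z)) ∧
          ((∀ x ∈ Ω \ K.domain, K.feFun z x = 0) →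
            MemH1 Ω (K.feFun z) ∧
            0 ≤ K.lumpedL1Norm z - ∫ x in Ω, |K.feFun z x| ∧
            K.lumpedL1Norm z - ∫ x in Ω, |K.feFun z x| ≤
              C * K.meshSize * h1Norm Ω (K.feFun z)) := by
  have hbound : ∀ (K : Triangulation n) {D : Set (EuclideanSpace ℝ (Fin n))}, D ⊆ Ω →
      ∀ z : K.nodes → ℝ, Real.sqrt (volume.real D) * K.meshSize * h1Norm D (K.feFun z) ≤
        (Real.sqrt (volume.real Ω) + 1) * K.meshSize * h1Norm D (K.feFun z) := by
    intro K D hD z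
    have hvol : volume.real D ≤ volume.real Ω := measureReal_mono hD hΩ_bdd.measure_lt_top.ne
    have hsqrt := (Real.sqrt_le_sqrt hvol).trans (le_add_of_nonneg_right zero_le_one)
    exact mul_le_mul_of_nonneg_right (mul_le_mul_of_nonneg_right hsqrt K.meshSize_nonneg)
      (Real.sqrt_nonneg _)
  -- The summand 1 keeps the constant positive even for empty `Ω`.
  refine ⟨Real.sqrt (volume.real Ω) + 1, by positivity, fun K _ hK z => ?_⟩
  have hconv := K.convex_domain hΩ_convex hK
  have hsub := K.domain_subset hK
  constructor
  · obtain ⟨h1, h2, h3⟩ := K.lumpedL1Norm_sub_integral_abs K.isOpen_domain hconv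
      K.isBounded_domain hconv subset_rfl z fun x hx => absurd hx.1 hx.2
    exact ⟨h1, h2, h3.trans (hbound K hsub z)⟩
  · intro hz
    obtain ⟨h1, h2, h3⟩ := K.lumpedL1Norm_sub_integral_abs hΩ_open hΩ_convex hΩ_bdd hconv hsub z hz
    exact ⟨h1, h2, h3.trans (hbound K subset_rfl z)⟩
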